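/- Let $m,n\ge 0$, let $S^n\subset\mathbb{R}^{n+1}$ be the unit sphere, and let $f:\mathbb{R}^m\to S^n$ be a smooth map. Write $\nabla$ for the connection on $f^*TS^n$ induced by the Levi-Civita connection of $S^n$, $Tf_\alpha=\partial_\alpha f$, and $\tau(f)=\sum_\alpha\nabla_\alpha Tf_\alpha$. Call $f$ a *soliton* if $\tau(f)(x)=Tf_x(x/2)$ for all $x\in\mathbb{R}^m$. For $x_0\in\mathbb{R}^m$, $t_0>0$ put $$G_{x_0,t_0}(x)=\frac{e^{-|x-x_0|^2/4t_0}}{(4\pi t_0)^{m/2}},\qquad \mathcal F_{x_0,t_0}(f)=\frac{t_0}{2}\int_{\mathbb{R}^m}|Tf|^2\,G_{x_0,t_0}\,dV,\qquad \lambda(f)=\sup_{x_0\in\mathbb{R}^m,\ t_0>0}\mathcal F_{x_0,t_0}(f)\in[0,\infty].$$ A soliton $f$ is *entropy stable* if it is a local minimizer of the entropy $\lambda$: there are $k\in\mathbb{N}$ and $\varepsilon>0$ such that $\lambda(f)\le\lambda(g)$ for every smooth $g:\mathbb{R}^m\to S^n$ with $|D^jg(x)-D^jf(x)|\le\varepsilon(1+|D^jf(x)|)$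 for all $x\in\mathbb{R}^m$ and $0\le j\le k$. (These neighbourhoods refine the compact-open $C^\infty$ topology, so a soliton that is not entropy stable is not a local minimizer in that topology either.) With $G=G_{0,1}$, let $L^fX=-\sum_\alpha\nabla_\alpha\nabla_\alpha X-\sum_\alpha R(X,Tf_\alpha)Tf_\alpha+\nabla_{x/2}X$ for smooth sections $X$ of $f^*TS^n$, where $R$ is the curvature tensor of $S^n$, $R(X,Y)Z=\langle Y,Z\rangle X-\langle X,Z\rangle Y$, and let $W^{2,2}_f$ be the set of those $X$ with $\int(|X|^2+|\nabla X|^2+|L^fX|^2)\,G\,dV<\infty$. A soliton $f$ is *$\mathcal F$-stable* if for every $X\in W^{2,2}_f$ there are $q\in\mathbb{R}$ and $V\in\mathbb{R}^m$ with $$\int_{\mathbb{R}^m}\langle X,\,L^fX-2q\,\tau(f)-Tf(V)\rangle\,G\,dV-\int_{\mathbb{R}^m}\Big(q^2|\tau(f)|^2+\tfrac12|Tf(V)|^2\Big)G\,dV\ \ge 0 .$$ For $w\in\mathbb{R}^{n+1}$ the *conformal vector field* of $S^n$ determined by $w$ is $W_p=w-\langle w,p\rangle p$, $p\in S^n$.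 **Corollary.** Let $f:\mathbb{R}^m\to S^n$ be a soliton with $\lambda(f)<\infty$. If there is a nonzero conformal vector field $W$ ($w\ne0$) such that $W_{f(x)}$ is perpendicular to the image of $Tf_x$ for every $x\in\mathbb{R}^m$, then $f$ is either constant or unstable, i.e. neither entropy stable nor $\mathcal F$-stable. In particular, this dichotomy holds for every soliton with $\lambda(f)<\infty$ whose image lies in a great sphere $S^n\cap H$, where $H\subsetneq\mathbb{R}^{n+1}$ is a proper linear subspace. -/

import Mathlib

open scoped ContDiff RealInnerProductSpace

noncomputable section

namespace HarmonicSoliton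

/-- `ℝ^k` with its Euclidean structure. -/
abbrev E (k : ℕ) : Type := EuclideanSpace ℝ (Fin k)

/-- The standard basis vector `∂_i` of `ℝ^k`. -/
def basisVec {k : ℕ} (i : Fin k) : E k := EuclideanSpace.single i 1

/-- `f` is a smooth map `ℝ^m → S^n`, where `S^n` is the unit sphere of `ℝ^{n+1}`. The sphere being an
embedded submanifold, smoothness is smoothness as a map into `ℝ^{n+1}`. -/
def IsSphereMap {m n : ℕ} (f : E m → E (n + 1)) : Prop :=
  ContDiff ℝ ∞ f ∧ ∀ x, f x ∈ Metric.sphere (0 : E (n + 1)) 1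

/-- Orthogonal projection of `ℝ^{n+1}` onto the tangent space `T_p S^n`, for a point `p` of `S^n`. -/
def tangentProj {n : ℕ} (p v : E (n + 1)) : E (n + 1) := v - ⟪v, p⟫ • p

/-- The pull-back Levi-Civita connection on `f^* T S^n`: the derivative `∇_v X` at `x` of a section
`X` of `f^* T S^n` (regarded as an `ℝ^{n+1}`-valued function) in the direction `v`. The Levi-Civita
connection of the round sphere is the tangential part of the flat derivative. -/
def covDeriv {m n : ℕ} (f X : E m → E (n + 1)) (v x : E m) : E (n + 1) :=
  tangentProj (f x) (fderiv ℝ X x v)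

/-- The tension field `τ(f) = tr ∇ Tf = ∑_α ∇_α (Tf_α)`. -/
def tension {m n : ℕ} (f : E m → E (n + 1)) (x : E m) : E (n + 1) :=
  ∑ i : Fin m, covDeriv f (fun y => fderiv ℝ f y (basisVec i)) (basisVec i) x

/-- A soliton `f : ℝ^m → S^n` (based at `(0,1)`): a smooth map with `τ(f) = (x/2) ⌟ Tf`. -/
def IsSoliton {m n : ℕ} (f : E m → E (n + 1)) : Prop :=
  IsSphereMap f ∧ ∀ x, tension f x = fderiv ℝ f x ((1 / 2 : ℝ) • x)

/-- `|Tf|²` at `x`. -/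
def energySq {m n : ℕ} (f : E m → E (n + 1)) (x : E m) : ℝ :=
  ∑ i : Fin m, ‖fderiv ℝ f x (basisVec i)‖ ^ 2

/-- The Gaussian weight `G_{x₀,t₀}(x) = (4 π t₀)^{-m/2} exp (-|x - x₀|² / (4 t₀))`. -/
def gaussian {m : ℕ} (x₀ : E m) (t₀ : ℝ) (x : E m) : ℝ :=
  Real.exp (-(‖x - x₀‖ ^ 2 / (4 * t₀))) / (4 * Real.pi * t₀) ^ ((m : ℝ) / 2)

/-- `𝓕_{x₀,t₀}(f) = (t₀/2) ∫ |Tf|² G_{x₀,t₀} dV`, with values in `[0,∞]`. -/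
def calF {m n : ℕ} (x₀ : E m) (t₀ : ℝ) (f : E m → E (n + 1)) : ENNReal :=
  ENNReal.ofReal (t₀ / 2) * ∫⁻ x, ENNReal.ofReal (energySq f x * gaussian x₀ t₀ x)

/-- The entropy `λ(f) = sup_{x₀ ∈ ℝ^m, t₀ > 0} 𝓕_{x₀,t₀}(f)`, with values in `[0,∞]`. -/
def entropy {m n : ℕ} (f : E m → E (n + 1)) : ENNReal :=
  ⨆ (x₀ : E m) (t₀ : ℝ) (_ : 0 < t₀), calF x₀ t₀ f

/-- `g` is `(k, ε)`-close to `f`: on all of `ℝ^m` the derivatives of order `0, …, k` of `g` differ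
from those of `f` by at most `ε (1 + |D^j f|)`. In particular `g` is uniformly close to `f`. On
compact sets this is `C^k`-closeness, so that these neighbourhoods refine the compact-open `C^∞`
topology; if all derivatives of `f` are bounded they generate the neighbourhoods of `f` in the
topology of uniform convergence of all derivatives. -/
def IsClose {m n : ℕ} (k : ℕ) (ε : ℝ) (f g : E m → E (n + 1)) : Prop :=
  ∀ j ≤ k, ∀ x, ‖iteratedFDeriv ℝ j g x - iteratedFDeriv ℝ j f x‖
    ≤ ε * (1 + ‖iteratedFDeriv ℝ j f x‖)

/-- A soliton is entropy stable if it is a local minimizer of the entropy among all smooth maps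
`ℝ^m → S^n`. -/
def IsEntropyStable {m n : ℕ} (f : E m → E (n + 1)) : Prop :=
  IsSoliton f ∧ ∃ k : ℕ, ∃ ε : ℝ, 0 < ε ∧
    ∀ g : E m → E (n + 1), IsSphereMap g → IsClose k ε f g → entropy f ≤ entropy g

/-- `X` is a smooth section of `f^* T S^n`. -/
def IsSection {m n : ℕ} (f X : E m → E (n + 1)) : Prop :=
  ContDiff ℝ ∞ X ∧ ∀ x, ⟪X x, f x⟫ = 0

/-- The curvature tensor `R(X,Y)Z = ⟨Y,Z⟩ X - ⟨X,Z⟩ Y` of the unit sphere. -/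
def sphereCurv {n : ℕ} (X Y Z : E (n + 1)) : E (n + 1) := ⟪Y, Z⟫ • X - ⟪X, Z⟫ • Y

/-- `L^f X = -Δ X - R(X, Tf_α) Tf_α + ∇_{x/2} X`, with `Δ = ∑_α ∇_α ∇_α`. -/
def opL {m n : ℕ} (f X : E m → E (n + 1)) (x : E m) : E (n + 1) :=
  -(∑ i : Fin m, covDeriv f (fun y => covDeriv f X (basisVec i) y) (basisVec i) x)
    - (∑ i : Fin m, sphereCurv (X x) (fderiv ℝ f x (basisVec i)) (fderiv ℝ f x (basisVec i)))
    + covDeriv f X ((1 / 2 : ℝ) • x) x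

/-- The space `W_f^{2,2}` of sections `X` with `∫ (|X|² + |∇X|² + |L^f X|²) G_{0,1} dV < ∞`. -/
def MemW22 {m n : ℕ} (f X : E m → E (n + 1)) : Prop :=
  IsSection f X ∧
    ∫⁻ x, ENNReal.ofReal ((‖X x‖ ^ 2 + (∑ i : Fin m, ‖covDeriv f X (basisVec i) x‖ ^ 2)
      + ‖opL f X x‖ ^ 2) * gaussian 0 1 x) < ⊤

/-- The second variation `𝓕''(q, V, X)` at a soliton `f`, for a variation `X` of `f` and variations
`V`, `q` of the base point `(x₀,t₀) = (0,1)`. -/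
def secondVar {m n : ℕ} (f : E m → E (n + 1)) (q : ℝ) (V : E m) (X : E m → E (n + 1)) : ℝ :=
  (∫ x, ⟪X x, opL f X x - (2 * q) • tension f x - fderiv ℝ f x V⟫ * gaussian 0 1 x)
    - ∫ x, (q ^ 2 * ‖tension f x‖ ^ 2 + 1 / 2 * ‖fderiv ℝ f x V‖ ^ 2) * gaussian 0 1 x

/-- A soliton `f` is `𝓕`-stable if for each `X ∈ W_f^{2,2}` there are `q ∈ ℝ` and a constant vector
field `V` on `ℝ^m` with `𝓕''(q, V, X) ≥ 0`. -/
def IsFStable {m n : ℕ} (f : E m → E (n + 1)) : Prop :=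
  IsSoliton f ∧ ∀ X, MemW22 f X → ∃ (q : ℝ) (V : E m), 0 ≤ secondVar f q V X

/-- The conformal vector field `W_p = w - ⟨w, p⟩ p` on `S^n` given by `w ∈ ℝ^{n+1}`. -/
def conformalField {n : ℕ} (w p : E (n + 1)) : E (n + 1) := w - ⟪w, p⟫ • p

end HarmonicSoliton

end

open scoped ContDiff RealInnerProductSpace
open MeasureTheory Filter Topology

namespace HarmonicSoliton

variable {m n : ℕ} {f : E m → E (n + 1)}

/-! ### Pointwise identities -/

/-! Normality of `W` along `f` means `⟪w, Tf⟫ = 0`, so `⟪w, f⟫` is a constant `c`. Pairing the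
soliton equation with `w` gives `|Tf|² c = 0`: either `f` is constant, or `c = 0` and the image lies
in the great sphere orthogonal to `w` (`IsSoliton.const_or_inner_eq_zero`).

In the second case let `u = w/|w|`, a parallel normal direction. Rotating `f` towards `u` by an
angle `s` multiplies the energy density by `cos² s`, hence also the entropy, which is positive and
finite and so strictly drops (`IsSphereMap.not_isEntropyStable`).

Infinitesimally, `L^f u = -|Tf|² u`, and `u` is orthogonal to `τ(f)` and to `Tf(V)`, so no choice of
`q`, `V` can compensate the negative value `-∫ |Tf|² G`. Finite entropy does not directly make `|L^f
u|² = |Tf|⁴` integrable against `G`, so `u` is replaced by `φ(ρx) u` with a bump function `φ`, and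
`ρ → 0` (`IsSphereMap.tendsto_integral_cutoff`, `IsSoliton.not_isFStable`). -/

lemma IsSphereMap.inner_self (hf : IsSphereMap f) (x : E m) : ⟪f x, f x⟫ = 1 := by
  have h := hf.2 x
  rw [mem_sphere_zero_iff_norm] at h
  rw [real_inner_self_eq_norm_sq, h, one_pow]

lemma IsSphereMap.differentiable (hf : IsSphereMap f) : Differentiable ℝ f :=
  hf.1.differentiable (by simp)

lemma IsSphereMap.contDiff_fderiv_apply (hf : IsSphereMap f) (v : E m) :
    ContDiff ℝ ∞ (fun y => fderiv ℝ f y v) :=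
  (hf.1.fderiv_right (m := ∞) (by simp)).clm_apply contDiff_const

lemma IsSphereMap.inner_fderiv (hf : IsSphereMap f) (x v : E m) : ⟪f x, fderiv ℝ f x v⟫ = 0 := by
  have h : fderiv ℝ (fun y => ⟪f y, f y⟫) x v = 0 := by
    simp only [hf.inner_self, fderiv_fun_const, Pi.zero_apply, zero_apply]
  rw [fderiv_inner_apply ℝ (hf.differentiable x) (hf.differentiable x),
    real_inner_comm (f x) (fderiv ℝ f x v)] at h
  linarith

lemma fderiv_inner_const (w : E (n + 1)) {g : E m → E (n + 1)} {x : E m}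
    (hg : DifferentiableAt ℝ g x) (v : E m) :
    fderiv ℝ (fun y => ⟪w, g y⟫) x v = ⟪w, fderiv ℝ g x v⟫ := by
  rw [fderiv_inner_apply ℝ (differentiableAt_const w) hg]
  simp

/-- Differentiate `⟪f, ∂_v f⟫ = 0` once more: this is the second fundamental form of the sphere. -/
lemma IsSphereMap.inner_fderiv_fderiv (hf : IsSphereMap f) (x v : E m) :
    ⟪f x, fderiv ℝ (fun y => fderiv ℝ f y v) x v⟫ = -‖fderiv ℝ f x v‖ ^ 2 := by
  have h : fderiv ℝ (fun y => ⟪f y, fderiv ℝ f y v⟫) x v = 0 := by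
    simp only [hf.inner_fderiv, fderiv_fun_const, Pi.zero_apply, zero_apply]
  rw [fderiv_inner_apply ℝ (hf.differentiable x)
    ((hf.contDiff_fderiv_apply v).differentiable (by simp) x), real_inner_self_eq_norm_sq] at h
  linarith

/-- If `w` is perpendicular to the image of `Tf`, then `⟨w, τ(f)⟩ = |Tf|² ⟨w, f⟩`. -/
lemma IsSphereMap.inner_tension (hf : IsSphereMap f) {w : E (n + 1)}
    (hw : ∀ x v, ⟪w, fderiv ℝ f x v⟫ = 0) (x : E m) :
    ⟪w, tension f x⟫ = energySq f x * ⟪w, f x⟫ := by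
  rw [tension, energySq, inner_sum, Finset.sum_mul]
  refine Finset.sum_congr rfl fun i _ => ?_
  have h : ⟪w, fderiv ℝ (fun y => fderiv ℝ f y (basisVec i)) x (basisVec i)⟫ = 0 := by
    rw [← fderiv_inner_const w
      ((hf.contDiff_fderiv_apply (basisVec i)).differentiable (by simp) x)]
    simp only [hw, fderiv_fun_const, Pi.zero_apply, zero_apply]
  rw [covDeriv, tangentProj, inner_sub_right, inner_smul_right, h,
    real_inner_comm (f x), hf.inner_fderiv_fderiv]
  ring

lemma inner_conformalField_fderiv (hf : IsSphereMap f) (w : E (n + 1)) (x v : E m) :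
    ⟪conformalField w (f x), fderiv ℝ f x v⟫ = ⟪w, fderiv ℝ f x v⟫ := by
  rw [conformalField, inner_sub_left, inner_smul_left, hf.inner_fderiv]
  simp

lemma energySq_nonneg (f : E m → E (n + 1)) (x : E m) : 0 ≤ energySq f x :=
  Finset.sum_nonneg fun _ _ => sq_nonneg _

lemma IsSphereMap.continuous_energySq (hf : IsSphereMap f) : Continuous (energySq f) :=
  continuous_finsetSum _ fun i _ => ((hf.contDiff_fderiv_apply (basisVec i)).continuous.norm.pow 2)

lemma fderiv_eq_zero_of_energySq_eq_zero {x : E m} (h : energySq f x = 0) :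
    fderiv ℝ f x = 0 := by
  have h' := (Finset.sum_eq_zero_iff_of_nonneg fun i _ => sq_nonneg _).1 h
  have : (fderiv ℝ f x).toLinearMap = 0 := by
    refine (EuclideanSpace.basisFun (Fin m) ℝ).toBasis.ext fun i => ?_
    have := h' i (Finset.mem_univ i)
    simpa [basisVec] using this
  ext1 v
  exact congrArg (fun l : E m →ₗ[ℝ] E (n + 1) => l v) this

lemma IsSphereMap.exists_eq_of_energySq_eq_zero (hf : IsSphereMap f) (h : ∀ x, energySq f x = 0) :
    ∃ p, ∀ x, f x = p :=
  ⟨f 0, fun x => is_const_of_fderiv_eq_zero hf.differentiable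
    (fun y => fderiv_eq_zero_of_energySq_eq_zero (h y)) x 0⟩

/-- If a conformal field is normal along a soliton, the soliton is constant or contained in the
great sphere perpendicular to the field's vector. -/
lemma IsSoliton.const_or_inner_eq_zero (hf : IsSoliton f) {w : E (n + 1)}
    (hw : ∀ x v, ⟪conformalField w (f x), fderiv ℝ f x v⟫ = 0) :
    (∃ p, ∀ x, f x = p) ∨ ∀ x, ⟪w, f x⟫ = 0 := by
  have hw' : ∀ x v, ⟪w, fderiv ℝ f x v⟫ = 0 := fun x v => by
    rw [← inner_conformalField_fderiv hf.1, hw]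
  have hc : ∀ x, ⟪w, f x⟫ = ⟪w, f 0⟫ := fun x => by
    refine is_const_of_fderiv_eq_zero (𝕜 := ℝ) (f := fun y => ⟪w, f y⟫)
      ((differentiable_const w).inner ℝ hf.1.differentiable) (fun y => ?_) x 0
    ext1 v
    rw [fderiv_inner_const w (hf.1.differentiable y), hw', zero_apply]
  -- Pair the soliton equation with `w`; its right side `Tf(x/2)` is orthogonal to `w`.
  have he : ∀ x, energySq f x * ⟪w, f 0⟫ = 0 := fun x => by
    rw [← hc x, ← hf.1.inner_tension hw', hf.2, hw']
  by_cases h0 : ⟪w, f 0⟫ = 0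
  · exact Or.inr fun x => (hc x).trans h0
  · exact Or.inl (hf.1.exists_eq_of_energySq_eq_zero fun x =>
      (mul_eq_zero.1 (he x)).resolve_right h0)

lemma IsSphereMap.inner_fderiv_eq_zero (hf : IsSphereMap f) {u : E (n + 1)}
    (hu : ∀ x, ⟪u, f x⟫ = 0) (x v : E m) : ⟪u, fderiv ℝ f x v⟫ = 0 := by
  rw [← fderiv_inner_const u (hf.differentiable x)]
  simp only [hu, fderiv_fun_const, Pi.zero_apply, zero_apply]

/-! ### Gaussian integrals -/

lemma gaussian_pos (x₀ : E m) {t₀ : ℝ} (ht : 0 < t₀) (x : E m) : 0 < gaussian x₀ t₀ x := by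
  unfold gaussian
  positivity

lemma continuous_gaussian (x₀ : E m) (t₀ : ℝ) : Continuous (gaussian x₀ t₀) := by
  unfold gaussian
  fun_prop

lemma integrable_gaussian : Integrable (gaussian (0 : E m) 1) := by
  have h := (GaussianFourier.integrable_cexp_neg_mul_sq_norm_add (V := E m) (b := 1 / 4)
    (by norm_num) 0 0).norm
  refine (h.div_const ((4 * Real.pi * 1) ^ ((m : ℝ) / 2))).congr (Eventually.of_forall fun x => ?_)
  simp only [gaussian, Complex.norm_exp]
  congr 2
  rw [zero_mul, add_zero, sub_zero, ← Complex.ofReal_pow, ← Complex.ofReal_one,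
    show (4 : ℂ) = ((4 : ℝ) : ℂ) by norm_num, ← Complex.ofReal_div, ← Complex.ofReal_neg,
    ← Complex.ofReal_mul, Complex.ofReal_re]
  ring

/-- The integrand is continuous and nonnegative, so a zero integral forces `Tf = 0` at every point.
-/
lemma IsSphereMap.calF_pos (hf : IsSphereMap f) (hne : ¬ ∃ p, ∀ x, f x = p) :
    0 < calF 0 1 f := by
  rw [pos_iff_ne_zero]
  intro h
  refine hne (hf.exists_eq_of_energySq_eq_zero fun x => ?_)
  have hc : Continuous fun x => energySq f x * gaussian 0 1 x :=
    hf.continuous_energySq.mul (continuous_gaussian 0 1)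
  have h0 : ∫⁻ x, ENNReal.ofReal (energySq f x * gaussian 0 1 x) = 0 := by
    simpa [calF] using h
  have h1 : (fun x => ENNReal.ofReal (energySq f x * gaussian 0 1 x)) = 0 :=
    (Continuous.ae_eq_iff_eq volume (ENNReal.continuous_ofReal.comp hc) continuous_zero).1
      ((lintegral_eq_zero_iff (ENNReal.continuous_ofReal.comp hc).measurable).1 h0)
  have h2 := ENNReal.ofReal_eq_zero.1 (congrFun h1 x)
  have hg := gaussian_pos (0 : E m) one_pos x
  nlinarith [energySq_nonneg f x]

lemma calF_le_entropy (f : E m → E (n + 1)) (x₀ : E m) {t₀ : ℝ} (ht : 0 < t₀) :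
    calF x₀ t₀ f ≤ entropy f :=
  le_iSup_of_le x₀ (le_iSup_of_le t₀ (le_iSup_of_le ht le_rfl))

lemma IsSphereMap.integrable_energySq_mul_gaussian (hf : IsSphereMap f)
    (hfin : entropy f < ⊤) : Integrable fun x => energySq f x * gaussian 0 1 x := by
  have hc : Continuous fun x => energySq f x * gaussian 0 1 x :=
    hf.continuous_energySq.mul (continuous_gaussian 0 1)
  refine ⟨hc.aestronglyMeasurable, ?_⟩
  rw [hasFiniteIntegral_iff_ofReal (Eventually.of_forall fun x =>
    mul_nonneg (energySq_nonneg f x) (gaussian_pos 0 one_pos x).le)]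
  have h := (calF_le_entropy f 0 one_pos).trans_lt hfin
  rw [calF, ENNReal.mul_lt_top_iff] at h
  rcases h with h | h | h
  · exact h.2
  · norm_num at h
  · rw [h]; exact ENNReal.zero_lt_top

lemma IsSphereMap.integral_energySq_pos (hf : IsSphereMap f) (hfin : entropy f < ⊤)
    (hne : ¬ ∃ p, ∀ x, f x = p) : 0 < ∫ x, energySq f x * gaussian 0 1 x := by
  have h := hf.calF_pos hne
  rw [calF, ← ofReal_integral_eq_lintegral_ofReal (hf.integrable_energySq_mul_gaussian hfin)
    (Eventually.of_forall fun x =>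
      mul_nonneg (energySq_nonneg f x) (gaussian_pos 0 one_pos x).le)] at h
  exact ENNReal.ofReal_pos.1 (pos_iff_ne_zero.2 (right_ne_zero_of_mul h.ne'))

/-! ### Entropy instability -/

/-- Rotation of `f` by the angle `s` towards the vector `u`. -/
noncomputable def tilt (s : ℝ) (u : E (n + 1)) (f : E m → E (n + 1)) (x : E m) : E (n + 1) :=
  Real.cos s • f x + Real.sin s • u

lemma IsSphereMap.tilt (hf : IsSphereMap f) {u : E (n + 1)} (hu1 : ‖u‖ = 1)
    (hu : ∀ x, ⟪u, f x⟫ = 0) (s : ℝ) : IsSphereMap (tilt s u f) := by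
  refine ⟨(hf.1.const_smul _).add contDiff_const, fun x => ?_⟩
  rw [mem_sphere_zero_iff_norm, ← sq_eq_sq₀ (norm_nonneg _) zero_le_one,
    HarmonicSoliton.tilt, norm_add_sq_real, inner_smul_left, inner_smul_right,
    real_inner_comm, hu, norm_smul, norm_smul, hu1, mem_sphere_zero_iff_norm.1 (hf.2 x)]
  simp

lemma IsSphereMap.energySq_tilt (hf : IsSphereMap f) (s : ℝ) (u : E (n + 1)) (x : E m) :
    energySq (HarmonicSoliton.tilt s u f) x = Real.cos s ^ 2 * energySq f x := by
  have h : fderiv ℝ (HarmonicSoliton.tilt s u f) x = Real.cos s • fderiv ℝ f x := by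
    unfold HarmonicSoliton.tilt
    rw [fderiv_add_const, fderiv_fun_const_smul (hf.differentiable x)]
  rw [energySq, energySq, h, Finset.mul_sum]
  refine Finset.sum_congr rfl fun i _ => ?_
  rw [smul_apply, norm_smul, mul_pow, Real.norm_eq_abs, sq_abs]

/-- The factor `cos² s` does not depend on `(x₀, t₀)`, so it passes through the supremum. -/
lemma IsSphereMap.entropy_tilt (hf : IsSphereMap f) (s : ℝ) (u : E (n + 1)) :
    entropy (HarmonicSoliton.tilt s u f) = ENNReal.ofReal (Real.cos s ^ 2) * entropy f := by
  have h : ∀ (x₀ : E m) (t₀ : ℝ), calF x₀ t₀ (HarmonicSoliton.tilt s u f)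
      = ENNReal.ofReal (Real.cos s ^ 2) * calF x₀ t₀ f := fun x₀ t₀ => by
    simp only [calF, hf.energySq_tilt, mul_assoc]
    simp only [ENNReal.ofReal_mul (sq_nonneg (Real.cos s))]
    rw [lintegral_const_mul' _ _ ENNReal.ofReal_ne_top]
    ring
  simp only [entropy, h, ENNReal.mul_iSup]

/-- The constant `sin s • u` is seen only at order `0`; otherwise every derivative is merely scaled
by `cos s`. The relative tolerance absorbs this without any bound on the derivatives of `f`. -/
lemma IsSphereMap.isClose_tilt (hf : IsSphereMap f) {u : E (n + 1)} (hu1 : ‖u‖ = 1)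
    (k : ℕ) {s ε : ℝ} (hs : 0 ≤ s) (hs1 : s ≤ 1) (hsε : s ≤ ε) :
    IsClose k ε f (HarmonicSoliton.tilt s u f) := by
  intro j _ x
  have hj : ContDiffAt ℝ j f x := (hf.1.of_le (by exact_mod_cast le_top)).contDiffAt
  have hd : iteratedFDeriv ℝ j (HarmonicSoliton.tilt s u f) x
      = Real.cos s • iteratedFDeriv ℝ j f x
        + iteratedFDeriv ℝ j (fun _ : E m => Real.sin s • u) x := by
    rw [← iteratedFDeriv_const_smul_apply hj, ← iteratedFDeriv_add_apply]
    · rfl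
    · exact contDiffAt_const.smul hj
    · exact contDiffAt_const
  have hc : ‖iteratedFDeriv ℝ j (fun _ : E m => Real.sin s • u) x‖ ≤ s := by
    rcases eq_or_ne j 0 with rfl | hj0
    · rw [norm_iteratedFDeriv_zero, norm_smul, hu1, mul_one, Real.norm_eq_abs]
      exact (Real.abs_sin_le_abs).trans_eq (abs_of_nonneg hs)
    · rw [iteratedFDeriv_const_of_ne hj0, Pi.zero_apply, norm_zero]
      exact hs
  have hcos : |Real.cos s - 1| ≤ s := by
    rw [abs_sub_comm, abs_of_nonneg (sub_nonneg.2 (Real.cos_le_one s))]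
    nlinarith [Real.one_sub_sq_div_two_le_cos (x := s)]
  calc ‖iteratedFDeriv ℝ j (HarmonicSoliton.tilt s u f) x - iteratedFDeriv ℝ j f x‖
      = ‖(Real.cos s - 1) • iteratedFDeriv ℝ j f x
        + iteratedFDeriv ℝ j (fun _ : E m => Real.sin s • u) x‖ := by
        rw [hd, sub_smul, one_smul]; congr 1; abel
    _ ≤ |Real.cos s - 1| * ‖iteratedFDeriv ℝ j f x‖ + s := by
        refine (norm_add_le _ _).trans (add_le_add ?_ hc)
        rw [norm_smul, Real.norm_eq_abs]
    _ ≤ ε * (1 + ‖iteratedFDeriv ℝ j f x‖) := by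
        nlinarith [mul_le_mul_of_nonneg_right (hcos.trans hsε)
          (norm_nonneg (iteratedFDeriv ℝ j f x))]

lemma IsSphereMap.not_isEntropyStable (hf : IsSphereMap f) (hfin : entropy f < ⊤)
    (hne : ¬ ∃ p, ∀ x, f x = p) {u : E (n + 1)} (hu1 : ‖u‖ = 1) (hu : ∀ x, ⟪u, f x⟫ = 0) :
    ¬ IsEntropyStable f := by
  rintro ⟨_, k, ε, hε, h⟩
  -- The angle `min ε 1`: at most `ε` for closeness, at most `1` for `1 - cos s ≤ s` and `sin s >
  -- 0`.
  have hs : 0 < min ε 1 := lt_min hε one_pos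
  have h1 := h _ (hf.tilt hu1 hu (min ε 1))
    (hf.isClose_tilt hu1 k hs.le (min_le_right _ _) (min_le_left _ _))
  rw [hf.entropy_tilt] at h1
  have hpos : 0 < entropy f := (hf.calF_pos hne).trans_le (calF_le_entropy f 0 one_pos)
  have hsin : 0 < Real.sin (min ε 1) :=
    Real.sin_pos_of_pos_of_le_one hs (min_le_right _ _)
  have hcos : ENNReal.ofReal (Real.cos (min ε 1) ^ 2) < 1 := by
    rw [← ENNReal.ofReal_one, ENNReal.ofReal_lt_ofReal_iff one_pos]
    nlinarith [Real.sin_sq_add_cos_sq (min ε 1), pow_pos hsin 2]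
  have h2 := ENNReal.mul_lt_mul_left hpos.ne' hfin.ne hcos
  rw [one_mul] at h2
  exact absurd h1 (not_le.2 h2)

/-! ### Instability of the second variation -/

/-- The Laplacian of a function on `ℝ^m`. -/
noncomputable def flatLaplacian (φ : E m → ℝ) (x : E m) : ℝ :=
  ∑ i : Fin m, fderiv ℝ (fun y => fderiv ℝ φ y (basisVec i)) x (basisVec i)

lemma contDiff_fderiv_apply_const {φ : E m → ℝ} (hφ : ContDiff ℝ ∞ φ) (v : E m) :
    ContDiff ℝ ∞ (fun y => fderiv ℝ φ y v) :=
  (hφ.fderiv_right (m := ∞) (by simp)).clm_apply contDiff_const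

lemma continuous_flatLaplacian {φ : E m → ℝ} (hφ : ContDiff ℝ ∞ φ) :
    Continuous (flatLaplacian φ) :=
  continuous_finsetSum _ fun _ _ =>
    (contDiff_fderiv_apply_const (contDiff_fderiv_apply_const hφ _) _).continuous

lemma covDeriv_smul_const {φ : E m → ℝ} {x : E m} (hφ : DifferentiableAt ℝ φ x)
    {u : E (n + 1)} (hu : ⟪u, f x⟫ = 0) (v : E m) :
    covDeriv f (fun y => φ y • u) v x = fderiv ℝ φ x v • u := by
  rw [covDeriv, fderiv_smul_const hφ, tangentProj]
  simp [inner_smul_left, hu]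

/-- As `u` is constant and orthogonal to `f`, covariant derivatives act on `φ` alone; as `u ⊥ Tf`,
the curvature term reduces to `|Tf|² φ u`. -/
lemma IsSphereMap.opL_smul_const (hf : IsSphereMap f) {φ : E m → ℝ} (hφ : ContDiff ℝ ∞ φ)
    {u : E (n + 1)} (hu : ∀ x, ⟪u, f x⟫ = 0) (x : E m) :
    opL f (fun y => φ y • u) x = (-flatLaplacian φ x - φ x * energySq f x
      + fderiv ℝ φ x ((1 / 2 : ℝ) • x)) • u := by
  have hd : Differentiable ℝ φ := hφ.differentiable (by simp)
  have h1 : ∀ (v y : E m), covDeriv f (fun y => φ y • u) v y = fderiv ℝ φ y v • u :=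
    fun v y => covDeriv_smul_const (hd y) (hu y) v
  have h2 : ∀ (v : E m), covDeriv f (fun y => fderiv ℝ φ y v • u) v x
      = fderiv ℝ (fun y => fderiv ℝ φ y v) x v • u := fun v =>
    covDeriv_smul_const ((contDiff_fderiv_apply_const hφ v).differentiable (by simp) x) (hu x) v
  simp only [opL, h1, h2, sphereCurv, inner_smul_left, hf.inner_fderiv_eq_zero hu,
    real_inner_self_eq_norm_sq, flatLaplacian, energySq, ← Finset.sum_smul, mul_zero, zero_smul,
    sub_zero, add_smul, sub_smul, neg_smul, smul_smul, ← Finset.sum_mul, mul_comm (φ x)]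

lemma lintegral_ofReal_lt_top_of_hasCompactSupport {h : E m → ℝ} (hc : Continuous h)
    (hs : HasCompactSupport h) : ∫⁻ x, ENNReal.ofReal (h x) < ⊤ :=
  (hc.integrable_of_hasCompactSupport hs).lintegral_lt_top

lemma IsSphereMap.memW22_smul_const (hf : IsSphereMap f) {φ : E m → ℝ} (hφ : ContDiff ℝ ∞ φ)
    (hs : HasCompactSupport φ) {u : E (n + 1)} (hu : ∀ x, ⟪u, f x⟫ = 0) :
    MemW22 f (fun y => φ y • u) := by
  have hd : Differentiable ℝ φ := hφ.differentiable (by simp)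
  have hfd : Continuous (fderiv ℝ φ) := hφ.continuous_fderiv (by simp)
  refine ⟨⟨hφ.smul contDiff_const, fun x => by rw [inner_smul_left, hu, mul_zero]⟩,
    lintegral_ofReal_lt_top_of_hasCompactSupport ?_ ?_⟩
  · simp only [hf.opL_smul_const hφ hu, covDeriv_smul_const (hd _) (hu _)]
    have := hφ.continuous
    have := hf.continuous_energySq
    have := continuous_flatLaplacian hφ
    have := continuous_gaussian (0 : E m) 1
    fun_prop
  -- Off the closed support `φ` vanishes near the point, so its derivatives vanish there too.
  · refine hs.of_isClosed_subset (isClosed_tsupport _) (closure_minimal ?_ (isClosed_tsupport φ))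
    intro x hx
    by_contra hxs
    have h0 : φ =ᶠ[𝓝 x] fun _ => 0 := notMem_tsupport_iff_eventuallyEq.1 hxs
    have h1 : ∀ᶠ y in 𝓝 x, fderiv ℝ φ y = 0 := by
      filter_upwards [h0.fderiv (𝕜 := ℝ)] with y hy
      rw [hy]; simp
    have h2 : flatLaplacian φ x = 0 := by
      refine Finset.sum_eq_zero fun i _ => ?_
      have : (fun y => fderiv ℝ φ y (basisVec i)) =ᶠ[𝓝 x] fun _ => 0 := by
        filter_upwards [h1] with y hy
        rw [hy]; rfl
      rw [this.fderiv_eq]; simp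
    refine hx ?_
    simp only [hf.opL_smul_const hφ hu, covDeriv_smul_const (hd _) (hu _), h2, h0.eq_of_nhds,
      h1.self_of_nhds]
    simp

/-- Both `τ(f) = Tf(x/2)` and `Tf(V)` are orthogonal to `u`, so `q` and `V` survive only in the
subtracted integral. That integral is nonnegative whether or not its integrand is integrable. -/
lemma IsSoliton.secondVar_smul_const_le (hf : IsSoliton f) {φ : E m → ℝ} (hφ : ContDiff ℝ ∞ φ)
    {u : E (n + 1)} (hu1 : ‖u‖ = 1) (hu : ∀ x, ⟪u, f x⟫ = 0) (q : ℝ) (V : E m) :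
    secondVar f q V (fun y => φ y • u) ≤ ∫ x, φ x * (-flatLaplacian φ x - φ x * energySq f x
      + fderiv ℝ φ x ((1 / 2 : ℝ) • x)) * gaussian 0 1 x := by
  have hnn : 0 ≤ ∫ x, (q ^ 2 * ‖tension f x‖ ^ 2 + 1 / 2 * ‖fderiv ℝ f x V‖ ^ 2)
      * gaussian 0 1 x :=
    integral_nonneg fun x => mul_nonneg (by positivity) (gaussian_pos 0 one_pos x).le
  refine (sub_le_self _ hnn).trans_eq (integral_congr_ae (Eventually.of_forall fun x => ?_))
  simp only [hf.1.opL_smul_const hφ hu, hf.2 x, inner_sub_right, inner_smul_left,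
    inner_smul_right, hf.1.inner_fderiv_eq_zero hu, real_inner_self_eq_norm_sq, hu1]
  simp only [conj_trivial, mul_zero, sub_zero, one_pow, mul_one]
  ring

/-! ### Rescaled cutoffs -/

lemma fderiv_comp_const_smul (φ : E m → ℝ) (ρ : ℝ) (x v : E m) :
    fderiv ℝ (fun y => φ (ρ • y)) x v = ρ * fderiv ℝ φ (ρ • x) v := by
  rw [fderiv_comp_smul]
  rfl

lemma flatLaplacian_comp_const_smul {φ : E m → ℝ} (hφ : ContDiff ℝ ∞ φ) (ρ : ℝ) (x : E m) :
    flatLaplacian (fun y => φ (ρ • y)) x = ρ ^ 2 * flatLaplacian φ (ρ • x) := by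
  have hd : Differentiable ℝ φ := hφ.differentiable (by simp)
  rw [flatLaplacian, flatLaplacian, Finset.mul_sum]
  refine Finset.sum_congr rfl fun i _ => ?_
  have hd' := (contDiff_fderiv_apply_const hφ (basisVec i)).differentiable (by simp)
  simp only [fderiv_comp_const_smul]
  have hc : DifferentiableAt ℝ (fun y => fderiv ℝ φ (ρ • y) (basisVec i)) x :=
    hd'.comp (differentiable_id.const_smul ρ) x
  rw [fderiv_const_mul hc,
    smul_apply, fderiv_comp_const_smul fun y => fderiv ℝ φ y (basisVec i), smul_eq_mul]
  ring

/-- The Laplacian term carries `ρ²`, while the drift term is a fixed compactly supported function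
evaluated at `ρx`. Both are thus bounded uniformly for small `ρ`, and `G` and `|Tf|² G` dominate; no
integration by parts is needed. -/
lemma IsSphereMap.tendsto_integral_cutoff (hf : IsSphereMap f) (hfin : entropy f < ⊤)
    {φ : E m → ℝ} (hφ : ContDiff ℝ ∞ φ) (hs : HasCompactSupport φ) (h0 : φ 0 = 1) :
    Tendsto (fun ρ : ℝ => ∫ x, φ (ρ • x) * (-flatLaplacian (fun y => φ (ρ • y)) x
      - φ (ρ • x) * energySq f x + fderiv ℝ (fun y => φ (ρ • y)) x ((1 / 2 : ℝ) • x))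
        * gaussian 0 1 x) (𝓝 0) (𝓝 (∫ x, -(energySq f x * gaussian 0 1 x))) := by
  have hd : Differentiable ℝ φ := hφ.differentiable (by simp)
  have hfd : Continuous (fderiv ℝ φ) := hφ.continuous_fderiv (by simp)
  have hφc := hφ.continuous
  have hlc := continuous_flatLaplacian hφ
  have hec := hf.continuous_energySq
  have hgc := continuous_gaussian (0 : E m) 1
  have heq : ∀ (ρ : ℝ) (x : E m), φ (ρ • x) * (-flatLaplacian (fun y => φ (ρ • y)) x
      - φ (ρ • x) * energySq f x + fderiv ℝ (fun y => φ (ρ • y)) x ((1 / 2 : ℝ) • x))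
        * gaussian 0 1 x
      = ((-ρ ^ 2 * (φ (ρ • x) * flatLaplacian φ (ρ • x))
        + φ (ρ • x) * fderiv ℝ φ (ρ • x) ((1 / 2 : ℝ) • ρ • x))
        - φ (ρ • x) ^ 2 * energySq f x) * gaussian 0 1 x := fun ρ x => by
    rw [flatLaplacian_comp_const_smul hφ, fderiv_comp_const_smul, smul_comm (1 / 2 : ℝ) ρ x,
      map_smul _ ρ, smul_eq_mul]
    ring
  simp only [heq]
  obtain ⟨A, hA⟩ := (hs.mul_right (f' := flatLaplacian φ)).exists_bound_of_continuous
    (hφc.mul hlc)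
  obtain ⟨B, hB⟩ := (hs.mul_right (f' := fun y => fderiv ℝ φ y ((1 / 2 : ℝ) • y))
    ).exists_bound_of_continuous (by fun_prop)
  obtain ⟨C, hC⟩ := hs.exists_bound_of_continuous hφc
  have hev : ∀ᶠ ρ : ℝ in 𝓝 0, ρ ^ 2 ≤ 1 := by
    have : Tendsto (fun ρ : ℝ => ρ ^ 2) (𝓝 0) (𝓝 (0 ^ 2)) := (continuous_pow 2).tendsto 0
    exact this.eventually_le_const (by norm_num)
  refine tendsto_integral_filter_of_dominated_convergence
    (fun x => (A + B) * gaussian 0 1 x + C ^ 2 * (energySq f x * gaussian 0 1 x))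
    (Eventually.of_forall fun ρ => Continuous.aestronglyMeasurable (by fun_prop)) ?_
    ((integrable_gaussian.const_mul _).add
      ((hf.integrable_energySq_mul_gaussian hfin).const_mul _))
    (Eventually.of_forall fun x => ?_)
  · filter_upwards [hev] with ρ hρ
    refine Eventually.of_forall fun x => ?_
    have hg := gaussian_pos (0 : E m) one_pos x
    have he := energySq_nonneg f x
    have hA' : |-ρ ^ 2 * (φ (ρ • x) * flatLaplacian φ (ρ • x))| ≤ A := by
      rw [abs_mul, abs_neg, abs_of_nonneg (sq_nonneg ρ)]
      exact (mul_le_of_le_one_left (abs_nonneg _) hρ).trans (hA (ρ • x))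
    have hC' : |φ (ρ • x) ^ 2 * energySq f x| ≤ C ^ 2 * energySq f x := by
      rw [abs_mul, abs_of_nonneg he, abs_pow]
      exact mul_le_mul_of_nonneg_right (pow_le_pow_left₀ (abs_nonneg _) (hC (ρ • x)) 2) he
    rw [norm_mul, Real.norm_eq_abs, Real.norm_eq_abs, abs_of_pos hg, ← mul_assoc (C ^ 2), ← add_mul]
    refine mul_le_mul_of_nonneg_right ((abs_sub _ _).trans (add_le_add ?_ hC')) hg.le
    exact (abs_add_le _ _).trans (add_le_add hA' (hB (ρ • x)))
  -- For fixed `x` the integrand is continuous in `ρ`, so its limit is its value at `ρ = 0`, where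
  -- only `-φ(0)² |Tf|² G` remains.
  · have hc : Continuous fun ρ : ℝ => ((-ρ ^ 2 * (φ (ρ • x) * flatLaplacian φ (ρ • x))
        + φ (ρ • x) * fderiv ℝ φ (ρ • x) ((1 / 2 : ℝ) • ρ • x))
        - φ (ρ • x) ^ 2 * energySq f x) * gaussian 0 1 x := by fun_prop
    simpa [h0] using hc.tendsto 0

lemma IsSoliton.not_isFStable (hf : IsSoliton f) (hfin : entropy f < ⊤)
    (hne : ¬ ∃ p, ∀ x, f x = p) {u : E (n + 1)} (hu1 : ‖u‖ = 1) (hu : ∀ x, ⟪u, f x⟫ = 0) :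
    ¬ IsFStable f := by
  rintro ⟨_, h⟩
  let φ : ContDiffBump (0 : E m) := default
  have hφ : ContDiff ℝ ∞ φ := φ.contDiff
  have h0 : φ 0 = 1 := φ.one_of_mem_closedBall (Metric.mem_closedBall_self φ.rIn_pos.le)
  have hlim := hf.1.tendsto_integral_cutoff hfin hφ φ.hasCompactSupport h0
  have hneg : ∫ x, -(energySq f x * gaussian 0 1 x) < 0 := by
    rw [integral_neg]
    exact neg_neg_of_pos (hf.1.integral_energySq_pos hfin hne)
  -- The limit is taken along `ρ ≠ 0`, since `φ(ρx)` must keep compact support.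
  obtain ⟨ρ, hρ, hρ0⟩ := ((hlim.mono_left nhdsWithin_le_nhds).eventually_lt_const hneg |>.and
    (self_mem_nhdsWithin : {0}ᶜ ∈ 𝓝[≠] (0 : ℝ))).exists
  have hφρ : ContDiff ℝ ∞ fun x : E m => φ (ρ • x) := hφ.comp (contDiff_id.const_smul ρ)
  have hsρ : HasCompactSupport fun x : E m => φ (ρ • x) := φ.hasCompactSupport.comp_smul hρ0
  obtain ⟨q, V, hqV⟩ := h _ (hf.1.memW22_smul_const hφρ hsρ hu)
  exact absurd (hqV.trans (hf.secondVar_smul_const_le hφρ hu1 hu q V)) (not_le.2 hρ)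

lemma IsSoliton.const_or_unstable (hf : IsSoliton f) (hfin : entropy f < ⊤) {w : E (n + 1)}
    (hw0 : w ≠ 0) (hw : ∀ x v, ⟪conformalField w (f x), fderiv ℝ f x v⟫ = 0) :
    (∃ p, ∀ x, f x = p) ∨ (¬ IsEntropyStable f ∧ ¬ IsFStable f) := by
  by_cases hne : ∃ p, ∀ x, f x = p
  · exact Or.inl hne
  have hwf := (hf.const_or_inner_eq_zero hw).resolve_left hne
  have hu1 : ‖‖w‖⁻¹ • w‖ = 1 := norm_smul_inv_norm (𝕜 := ℝ) hw0
  have hu : ∀ x, ⟪‖w‖⁻¹ • w, f x⟫ = 0 := fun x => by rw [inner_smul_left, hwf, mul_zero]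
  exact Or.inr ⟨hf.1.not_isEntropyStable hfin hne hu1 hu, hf.not_isFStable hfin hne hu1 hu⟩

end HarmonicSoliton

theorem mainTheorem5 (m n : ℕ) (f : HarmonicSoliton.E m → HarmonicSoliton.E (n + 1))
    (hf : HarmonicSoliton.IsSoliton f) (hfin : HarmonicSoliton.entropy f < ⊤) :
    ((∃ w : HarmonicSoliton.E (n + 1), w ≠ 0 ∧
        ∀ x v, inner ℝ (HarmonicSoliton.conformalField w (f x)) (fderiv ℝ f x v) = 0) →
      (∃ p, ∀ x, f x = p) ∨
        (¬ HarmonicSoliton.IsEntropyStable f ∧ ¬ HarmonicSoliton.IsFStable f)) ∧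
    ((∃ S : Submodule ℝ (HarmonicSoliton.E (n + 1)), S ≠ ⊤ ∧ ∀ x, f x ∈ S) →
      (∃ p, ∀ x, f x = p) ∨
        (¬ HarmonicSoliton.IsEntropyStable f ∧ ¬ HarmonicSoliton.IsFStable f)) := by
  refine ⟨fun ⟨w, hw0, hw⟩ => hf.const_or_unstable hfin hw0 hw, fun ⟨S, hS, hfS⟩ => ?_⟩
  -- Any nonzero `w` orthogonal to the proper subspace gives a conformal field normal along `f`.
  obtain ⟨w, hwS, hw0⟩ := Submodule.exists_mem_ne_zero_of_ne_bot
    (mt Submodule.orthogonal_eq_bot_iff.1 hS)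
  refine hf.const_or_unstable hfin hw0 fun x v => ?_
  rw [HarmonicSoliton.inner_conformalField_fderiv hf.1]
  exact hf.1.inner_fderiv_eq_zero (fun y => Submodule.inner_left_of_mem_orthogonal (hfS y) hwS) x v
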